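/- Let $f\colon X\to S$ be a morphism of noetherian schemes. Say that $f$ is \emph{essentially of finite type} if every point of $S$ has an affine open neighbourhood $V=\operatorname{Spec}A$ such that $f^{-1}(V)$ is covered by finitely many affine open subschemes $U_i=\operatorname{Spec}B_i\subseteq f^{-1}(V)$ for which each $B_i$ is, via the ring homomorphism $A\to B_i$ induced by $f$, a localization (at some multiplicative subset) of a finitely generated $A$-algebra. If $f$ is separated, essentially of finite type and universally closed, then $f$ is of finite type (that is, locally of finite type and quasi-compact), and hence proper. Conversely, every proper $f$ is separated, essentially of finite type and universally closed; thus replacing ``finite type'' by ``essentially finite type'' in the definition of properness does not define a new condition. -/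

import Mathlib

open AlgebraicGeometry CategoryTheory

universe u

/-- A morphism `f : X ⟶ Y` of schemes is essentially of finite type if every point of `Y` has an
affine open neighbourhood `V = Spec A` such that `f⁻¹ V` is covered by finitely many affine opens
`U = Spec B` for which the ring homomorphism `A → B` is essentially of finite type, i.e. `B` is a
localization of a finitely generated `A`-algebra. -/
def EssentiallyOfFiniteType {X Y : Scheme.{u}} (f : X ⟶ Y) : Prop :=
  ∀ y : Y, ∃ V : Y.Opens, y ∈ V ∧ IsAffineOpen V ∧
    ∃ 𝒰 : Set X.Opens, 𝒰.Finite ∧ sSup 𝒰 = f ⁻¹ᵁ V ∧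
      ∀ U ∈ 𝒰, IsAffineOpen U ∧
        ∃ e : U ≤ f ⁻¹ᵁ V, (f.appLE V U e).hom.EssFiniteType

section LocalizingImmersions

open Limits Topology

/-! Locally `X` contains an open `U = Spec B`, with `B` a localization of a noetherian finite type
algebra `C`. Let `Z` be the closure of the image of `U` in `X ×_S Spec C`. By separatedness, `Z` has
no new points over `U ⊆ X` or over the image of `U` in `Spec C`. Since `Z` projects to `Spec C` by a
closed map, that image is locally closed. It is also stable under generalization, hence open, so `U`
is open in `Spec C` and locally of finite type over `S`. -/

/-- If `q : P ⟶ Y` is separated and `γ : U ⟶ P` is such that `γ ≫ q` is a preimmersion, then the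
image of `γ` is closed in the preimage of the image of `γ ≫ q`. -/
lemma closure_range_inter_preimage_range_subset {U P Y : Scheme.{u}} (γ : U ⟶ P) (q : P ⟶ Y)
    [IsSeparated q] [IsPreimmersion (γ ≫ q)] :
    closure (Set.range γ) ∩ q ⁻¹' Set.range (γ ≫ q) ⊆ Set.range γ := by
  -- `δ` is a section of a base change of `q`, hence a closed immersion.
  let δ : U ⟶ pullback q (γ ≫ q) := pullback.lift γ (𝟙 U) (by simp)
  let k : pullback q (γ ≫ q) ⟶ P := pullback.fst q (γ ≫ q)
  have e : δ ≫ k = γ := pullback.lift_fst _ _ _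
  have hδ : IsClosedImmersion δ := by
    have : IsClosedImmersion (δ ≫ pullback.snd q (γ ≫ q)) := by
      rw [pullback.lift_snd]; infer_instance
    exact IsClosedImmersion.of_comp δ (pullback.snd q (γ ≫ q))
  have hk : ∀ u, k (δ u) = γ u := fun u ↦ by rw [← Scheme.Hom.comp_apply, e]
  rw [← Scheme.Pullback.range_fst]
  rintro _ ⟨hx, y, rfl⟩
  have h1 : y ∈ closure (Set.range δ) := by
    rw [k.isEmbedding.closure_eq_preimage_closure_image, Set.mem_preimage, ← Set.range_comp]
    convert hx using 3
    exact funext hk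
  rw [δ.isClosedEmbedding.isClosed_range.closure_eq] at h1
  obtain ⟨u, rfl⟩ := h1
  exact ⟨u, (hk u).symm⟩

/-- A preimmersion into `Y` from an open subscheme of a separated and universally closed
`S`-scheme is locally closed, if `Y` is separated over `S`. -/
lemma isLocallyClosed_range_of_universallyClosed {U X Y S : Scheme.{u}} (f : X ⟶ S) [IsSeparated f]
    [UniversallyClosed f] (p : Y ⟶ S) [IsSeparated p] (i : U ⟶ X) [IsOpenImmersion i] (j : U ⟶ Y)
    [IsPreimmersion j] (h : i ≫ f = j ≫ p) : IsLocallyClosed (Set.range j) := by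
  let γ := pullback.lift (f := f) (g := p) i j h
  have hγf : γ ≫ pullback.fst f p = i := pullback.lift_fst _ _ _
  have hγs : γ ≫ pullback.snd f p = j := pullback.lift_snd _ _ _
  have h₁ : closure (Set.range γ) ∩ pullback.snd f p ⁻¹' Set.range j ⊆ Set.range γ := by
    have : IsPreimmersion (γ ≫ pullback.snd f p) := hγs ▸ ‹_›
    simpa only [hγs] using closure_range_inter_preimage_range_subset γ (pullback.snd f p)
  have h₂ : closure (Set.range γ) ∩ pullback.fst f p ⁻¹' Set.range i ⊆ Set.range γ := by
    have : IsPreimmersion (γ ≫ pullback.fst f p) := hγf ▸ inferInstance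
    simpa only [hγf] using closure_range_inter_preimage_range_subset γ (pullback.fst f p)
  have hs : ∀ u, pullback.snd f p (γ u) = j u := fun u ↦ by
    rw [← Scheme.Hom.comp_apply, hγs]
  have hf : ∀ u, pullback.fst f p (γ u) = i u := fun u ↦ by
    rw [← Scheme.Hom.comp_apply, hγf]
  have hc : IsClosedMap (pullback.snd f p) := (pullback.snd f p).isClosedMap
  -- A difference of two closed sets: the image of `Z = closure (Set.range γ)` minus the image of
  -- the part of `Z` not over `U ⊆ X`.
  have e : Set.range j = pullback.snd f p '' closure (Set.range γ) \
      pullback.snd f p '' (closure (Set.range γ) \ pullback.fst f p ⁻¹' Set.range i) := by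
    ext y
    constructor
    · rintro ⟨u, rfl⟩
      refine ⟨⟨γ u, subset_closure ⟨u, rfl⟩, hs u⟩, ?_⟩
      rintro ⟨z, ⟨hz, hz'⟩, e⟩
      obtain ⟨v, rfl⟩ := h₁ ⟨hz, u, e.symm⟩
      exact hz' ⟨v, (hf v).symm⟩
    · rintro ⟨⟨z, hz, rfl⟩, hy⟩
      by_contra hj
      refine hy ⟨z, ⟨hz, fun hi ↦ ?_⟩, rfl⟩
      obtain ⟨v, rfl⟩ := h₂ ⟨hz, hi⟩
      exact hj ⟨v, (hs v).symm⟩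
  rw [e, Set.sdiff_eq]
  exact (hc _ isClosed_closure).isLocallyClosed.inter
    (hc _ (isClosed_closure.sdiff (i.isOpenEmbedding.isOpen_range.preimage
      (pullback.fst f p).continuous))).isOpen_compl.isLocallyClosed

/-- A flat preimmersion with open image is an open immersion. -/
lemma isOpenImmersion_of_flat_of_isPreimmersion {U Y : Scheme.{u}} (j : U ⟶ Y) [Flat j]
    [IsPreimmersion j] (h : IsOpen (Set.range j)) : IsOpenImmersion j := by
  have : ∀ x, IsIso (j.stalkMap x) := fun x ↦ by
    rw [ConcreteCategory.isIso_iff_bijective]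
    refine ⟨?_, j.stalkMap_surjective x⟩
    have h1 := Flat.stalkMap j x
    algebraize [(j.stalkMap x).hom]
    have : IsLocalHom (algebraMap (Y.presheaf.stalk (j x)) (U.presheaf.stalk x)) :=
      inferInstanceAs (IsLocalHom (j.stalkMap x).hom)
    have : Module.FaithfullyFlat (Y.presheaf.stalk (j x)) (U.presheaf.stalk x) :=
      Module.FaithfullyFlat.of_flat_of_isLocalHom
    exact FaithfulSMul.algebraMap_injective (Y.presheaf.stalk (j x)) (U.presheaf.stalk x)
  exact IsOpenImmersion.of_isIso_stalkMap j ⟨j.isEmbedding, h⟩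

/-- A locally closed subset of a noetherian affine scheme that is stable under generalization is
open. -/
lemma isOpen_of_isLocallyClosed_of_stableUnderGeneralization {R : CommRingCat.{u}}
    [IsNoetherianRing R] {s : Set (Spec R)} (hs : IsLocallyClosed s)
    (hs' : StableUnderGeneralization s) : IsOpen s := by
  refine PrimeSpectrum.isOpen_of_stableUnderGeneralization_of_isConstructible hs' ?_
  have ho {t : Set (PrimeSpectrum R)} (ht : IsOpen t) : IsConstructible t :=
    (TopologicalSpace.NoetherianSpace.isCompact t).isConstructible ht
  obtain ⟨t, z, ht, hz, rfl⟩ := hs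
  exact (ho ht).inter (isConstructible_compl.mp (ho hz.isOpen_compl))

/-- If `Spec B` is open in a separated and universally closed `S`-scheme, where `B` is a localization
of a noetherian ring `C` with `Spec C` separated over `S`, then `Spec B ⟶ Spec C` is an open
immersion. -/
lemma isOpenImmersion_SpecMap_of_isLocalization {C B : Type u} [CommRing C] [CommRing B]
    [Algebra C B] [IsNoetherianRing C] (M : Submonoid C) [IsLocalization M B]
    {X S : Scheme.{u}} (f : X ⟶ S) [IsSeparated f] [UniversallyClosed f]
    (p : Spec (.of C) ⟶ S) [IsSeparated p] (i : Spec (.of B) ⟶ X) [IsOpenImmersion i]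
    (h : i ≫ f = Spec.map (CommRingCat.ofHom (algebraMap C B)) ≫ p) :
    IsOpenImmersion (Spec.map (CommRingCat.ofHom (algebraMap C B))) := by
  have : IsPreimmersion (Spec.map (CommRingCat.ofHom (algebraMap C B))) := .of_isLocalization M
  have : Flat (Spec.map (CommRingCat.ofHom (algebraMap C B))) := by
    rw [Flat.SpecMap_iff]
    exact RingHom.flat_algebraMap_iff.mpr (IsLocalization.flat B M)
  exact isOpenImmersion_of_flat_of_isPreimmersion _
    (isOpen_of_isLocallyClosed_of_stableUnderGeneralization (R := .of C)
      (isLocallyClosed_range_of_universallyClosed f p i _ h)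
      (Flat.generalizingMap _).stableUnderGeneralization_range)

end LocalizingImmersions

/-- Separated and universally closed morphisms to a locally noetherian scheme are locally of finite
type on affine opens on which they are essentially of finite type. -/
lemma locallyOfFiniteType_ι_comp_of_essFiniteType {X S : Scheme.{u}} (f : X ⟶ S) [IsSeparated f]
    [UniversallyClosed f] [IsLocallyNoetherian S] {V : S.Opens} (hV : IsAffineOpen V)
    {U : X.Opens} (hU : IsAffineOpen U) (e : U ≤ f ⁻¹ᵁ V)
    (h : (f.appLE V U e).hom.EssFiniteType) : LocallyOfFiniteType (U.ι ≫ f) := by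
  have : IsNoetherianRing Γ(S, V) := IsLocallyNoetherian.component_noetherian ⟨V, hV⟩
  algebraize [(f.appLE V U e).hom]
  -- A finitely generated subalgebra of which `Γ(X, U)` is a localization.
  let C := Algebra.EssFiniteType.subalgebra Γ(S, V) Γ(X, U)
  have : IsNoetherianRing C := Algebra.FiniteType.isNoetherianRing Γ(S, V) C
  let p : Spec (.of C) ⟶ S :=
    Spec.map (CommRingCat.ofHom (algebraMap Γ(S, V) C)) ≫ hV.fromSpec
  have hp : LocallyOfFiniteType (Spec.map (CommRingCat.ofHom (algebraMap Γ(S, V) C))) := by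
    rw [HasRingHomProperty.Spec_iff (P := @LocallyOfFiniteType)]
    exact RingHom.finiteType_algebraMap.mpr inferInstance
  have hc : hU.fromSpec ≫ f = Spec.map (CommRingCat.ofHom (algebraMap C Γ(X, U))) ≫ p := by
    rw [← IsAffineOpen.SpecMap_appLE_fromSpec f hV hU e, ← Spec.map_comp_assoc]
    rfl
  have := isOpenImmersion_SpecMap_of_isLocalization
    (Algebra.EssFiniteType.submonoid Γ(S, V) Γ(X, U)) f p hU.fromSpec hc
  have : LocallyOfFiniteType (hU.fromSpec ≫ f) := by
    rw [hc]; infer_instance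
  rw [← hU.isoSpec_hom_fromSpec, Category.assoc]
  infer_instance

lemma EssentiallyOfFiniteType.locallyOfFiniteType {X S : Scheme.{u}} {f : X ⟶ S}
    (h : EssentiallyOfFiniteType f) [IsSeparated f] [UniversallyClosed f]
    [IsLocallyNoetherian S] : LocallyOfFiniteType f := by
  have (x : X) : ∃ U : X.Opens, x ∈ U ∧ LocallyOfFiniteType (U.ι ≫ f) := by
    obtain ⟨V, hxV, hV, 𝒰, -, h𝒰, H⟩ := h (f x)
    have hx : x ∈ sSup 𝒰 := h𝒰 ▸ hxV
    obtain ⟨U, hU, hxU⟩ := TopologicalSpace.Opens.mem_sSup.mp hx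
    obtain ⟨hU', e, he⟩ := H U hU
    exact ⟨U, hxU, locallyOfFiniteType_ι_comp_of_essFiniteType f hV hU' e he⟩
  choose U hxU hU using this
  have hloc : IsZariskiLocalAtSource @LocallyOfFiniteType :=
    HasRingHomProperty.instIsZariskiLocalAtSource (Q := RingHom.FiniteType)
  rw [hloc.iff_of_iSup_eq_top U
    (eq_top_iff.mpr fun x _ ↦ TopologicalSpace.Opens.mem_iSup.mpr ⟨x, hxU x⟩)]
  exact hU

lemma essentiallyOfFiniteType_of_locallyOfFiniteType {X S : Scheme.{u}} (f : X ⟶ S)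
    [LocallyOfFiniteType f] [QuasiCompact f] : EssentiallyOfFiniteType f := by
  intro y
  obtain ⟨V, hV, hyV, -⟩ := (TopologicalSpace.Opens.isBasis_iff_nbhd.mp S.isBasis_affineOpens)
    (show y ∈ (⊤ : S.Opens) from trivial)
  have hc : IsCompact (f ⁻¹ᵁ V : Set X) := f.isCompact_preimage hV.isCompact
  obtain ⟨s, hs, e⟩ := isCompact_iff_finite_and_eq_biUnion_affineOpens.mp hc
  refine ⟨V, hyV, hV, (↑) '' s, hs.image _, ?_, ?_⟩
  · rw [e, sSup_image]
  · rintro _ ⟨U, hU, rfl⟩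
    have hle : U.1 ≤ f ⁻¹ᵁ V := by rw [e]; exact le_iSup₂_of_le U hU le_rfl
    exact ⟨U.2, hle, (f.finiteType_appLE hV U.2 hle).essFiniteType⟩

theorem mainTheorem11 {X S : Scheme.{u}} [IsNoetherian X] [IsNoetherian S] (f : X ⟶ S) :
    (IsSeparated f ∧ EssentiallyOfFiniteType f ∧ UniversallyClosed f →
      (LocallyOfFiniteType f ∧ QuasiCompact f) ∧ IsProper f) ∧
    (IsProper f →
      IsSeparated f ∧ EssentiallyOfFiniteType f ∧ UniversallyClosed f) := by
  refine ⟨fun ⟨_, h, _⟩ ↦ ?_, fun _ ↦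
    ⟨inferInstance, essentiallyOfFiniteType_of_locallyOfFiniteType f, inferInstance⟩⟩
  have := h.locallyOfFiniteType
  exact ⟨⟨this, inferInstance⟩, { }⟩
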